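/- Let $\mathcal X$ and $\mathcal Y$ be finite nonempty alphabets, let $Q(y\mid x,y')>0$ be strictly positive channel constants with $\sum_{y}Q(y\mid x,y')=1$ for all $(x,y')\in\mathcal X\times\mathcal Y$, and let $P_0$ be any probability distribution on $\mathcal Y$. The NOST (Noisy Output is the STate) channel has an initial output $Y_0\sim P_0$, known to encoder and decoder, inputs $X_t\in\mathcal X$ and outputs $Y_t\in\mathcal Y$ for $t\ge 1$, with $P_{Y_t\mid X^t,Y^{t-1}}(y\mid\cdot)=Q(y\mid X_t,Y_{t-1})$, where $X^t=(X_1,\dots,X_t)$ and $Y^{t}=(Y_0,\dots,Y_{t})$. An $(n,M,\epsilon)$-code consists of feedback encoding maps $f_t:[M]\times\mathcal Y^{t}\to\mathcal X$, $X_t=f_t(W,Y_0,\dots,Y_{t-1})$ for $1\le t\le n$, where the message $W$ is uniform on $[M]=\{1,\dots,M\}$ and independent of $Y_0$, and a decoding map $g:\mathcal Y^{n+1}\to[M]$, $\hat W=g(Y_0,\dots,Y_n)$, with $\mathbb P[W\ne\hat W]\le\epsilon$. Let $M^*(n,\epsilon)$ be the largest $M$ for which an $(n,M,\epsilon)$-code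 exists, and $$C^{\mathrm{fb}}_{\mathrm{NOST}}=\lim_{\epsilon\to0^+}\ \liminf_{n\to\infty}\ \frac1n\log M^*(n,\epsilon).$$ Then this limit exists in $\mathbb R$, the maximum below is attained, and $$C^{\mathrm{fb}}_{\mathrm{NOST}}\ \le\ \max_{P_{X,Y'}}\ I(X;Y\mid Y')\quad\text{subject to } P_Y=P_{Y'},$$ where $P_{X,Y'}$ ranges over the probability distributions on $\mathcal X\times\mathcal Y$, and $Y$ is the channel output, $P_{X,Y',Y}(x,y',y)=P_{X,Y'}(x,y')\,Q(y\mid x,y')$. The same upper bound holds for the directed-information form of the feedback capacity: $$\limsup_{n\to\infty}\ \sup_{\{P_{X_t\mid X^{t-1},Y^{t-1}}\}_{t=1}^n}\ \frac1n\sum_{t=1}^n I(X^t;Y_t\mid Y^{t-1})\ \le\ \max_{P_{X,Y'}:\,P_Y=P_{Y'}} I(X;Y\mid Y').$$ -/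

import Mathlib

open Filter Topology

noncomputable section

/-- The conditional mutual information `I(A ; B | C)`, in nats, of finite-valued random variables
with joint probability mass function `p a b c = P(A = a, B = b, C = c)`:
`∑ p(a,b,c) log (p(a,b,c) p(c) / (p(a,c) p(b,c)))`. Terms with `p a b c = 0` vanish. -/
def condMutualInfo {A B C : Type*} [Fintype A] [Fintype B] [Fintype C]
    (p : A → B → C → ℝ) : ℝ :=
  ∑ a, ∑ b, ∑ c, p a b c *
    Real.log (p a b c * (∑ a', ∑ b', p a' b' c) / ((∑ b', p a b' c) * (∑ a', p a' b c)))

/-- A NOST (Noisy Output is the STate) channel with input alphabet `X` and output alphabet `Y`: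
a strictly positive stationary transition law, `Q x y' y = Q(y | x, y')`, where `x` is the current
input, `y'` the previous output and `y` the current output. The nodes are `0, 1, 2, …`, each with
an edge to the next; node `0` is initial, it carries an output `Y_0` only; each node `t ≥ 1`
carries an input `X_t` and an output `Y_t`. -/
structure NOSTChannel (X Y : Type*) [Fintype Y] where
  Q : X → Y → Y → ℝ
  pos : ∀ x y' y, 0 < Q x y' y
  sum_eq_one : ∀ x y', ∑ y, Q x y' y = 1

namespace NOSTChannel

variable {X Y : Type*} [Fintype X] [Fintype Y]

/-! ### Feedback codes and the operational feedback capacity -/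

/-- An encoder with feedback for `M` messages: `f t w (y_0, …, y_t)` is the input `X_{t+1}` at node
`t + 1`, when the message is `w` and the outputs of the preceding nodes are `y_0, …, y_t`. -/
abbrev Encoder (X Y : Type*) (M : ℕ) : Type _ := (t : ℕ) → Fin M → (Fin (t + 1) → Y) → X

/-- The probability of the outputs `(Y_0, …, Y_n) = y`, given that the message is `w`, when
`Y_0` has distribution `P₀` (independently of the message). -/
def outputLaw (ch : NOSTChannel X Y) (P₀ : Y → ℝ) {M : ℕ} (f : Encoder X Y M) (w : Fin M)
    (n : ℕ) (y : Fin (n + 1) → Y) : ℝ :=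
  P₀ (y 0) * ∏ t : Fin n,
    ch.Q (f t w fun i : Fin (t + 1) => y ⟨i, by omega⟩) (y t.castSucc) (y t.succ)

/-- The error probability `P[W ≠ Ŵ]` after `n` stages, for a uniformly distributed message `W`
and the decoder `g`. -/
def errorProb (ch : NOSTChannel X Y) (P₀ : Y → ℝ) {M : ℕ} (f : Encoder X Y M) (n : ℕ)
    (g : (Fin (n + 1) → Y) → Fin M) : ℝ :=
  (∑ w : Fin M, ∑ y : Fin (n + 1) → Y, if g y ≠ w then ch.outputLaw P₀ f w n y else 0) / M

/-- There is an `(n, M, ε)`-code. -/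
def HasCode (ch : NOSTChannel X Y) (P₀ : Y → ℝ) (n M : ℕ) (ε : ℝ) : Prop :=
  ∃ (f : Encoder X Y M) (g : (Fin (n + 1) → Y) → Fin M), ch.errorProb P₀ f n g ≤ ε

/-- `M*(n, ε)`, the largest message size of an `(n, M, ε)`-code (finite when `ε < 1`). -/
def maxMessages (ch : NOSTChannel X Y) (P₀ : Y → ℝ) (n : ℕ) (ε : ℝ) : ℕ :=
  sSup {M : ℕ | ch.HasCode P₀ n M ε}

/-- `C` is the feedback capacity `lim_{ε → 0⁺} liminf_{n → ∞} (1/n) log M*(n, ε)`. -/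
def IsFeedbackCapacity (ch : NOSTChannel X Y) (P₀ : Y → ℝ) (C : ℝ) : Prop :=
  Tendsto (fun ε : ℝ => liminf (fun n : ℕ => Real.log (ch.maxMessages P₀ n ε) / n) atTop)
    (𝓝[>] 0) (𝓝 C)

/-! ### Directed information -/

/-- Channel input distributions: `π t (x_1, …, x_t) (y_0, …, y_t) x` is the conditional probability
`P(X_{t+1} = x | X_1 = x_1, …, X_t = x_t, Y_0 = y_0, …, Y_t = y_t)`. -/
abbrev InputDist (X Y : Type*) : Type _ := (t : ℕ) → (Fin t → X) → (Fin (t + 1) → Y) → X → ℝ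

/-- Each `π t xs ys` is a probability distribution on the input alphabet. -/
def IsInputDist (π : InputDist X Y) : Prop :=
  ∀ (t : ℕ) (xs : Fin t → X) (ys : Fin (t + 1) → Y), π t xs ys ∈ stdSimplex ℝ X

/-- The joint law of `(X_1, …, X_n)` and `(Y_0, …, Y_n)`, when `Y_0` has distribution `P₀`. -/
def jointLaw (ch : NOSTChannel X Y) (P₀ : Y → ℝ) (π : InputDist X Y) (n : ℕ)
    (x : Fin n → X) (y : Fin (n + 1) → Y) : ℝ :=
  P₀ (y 0) * ∏ t : Fin n,
    (π t (fun i : Fin t => x ⟨i, by omega⟩) (fun i : Fin (t + 1) => y ⟨i, by omega⟩) (x t) *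
      ch.Q (x t) (y t.castSucc) (y t.succ))

/-- The directed information `∑_{t=1}^n I(X_1, …, X_t ; Y_t | Y_0, …, Y_{t-1})`; the summation
index below is `t - 1`. -/
def directedInfo (ch : NOSTChannel X Y) (P₀ : Y → ℝ) (π : InputDist X Y) (n : ℕ) : ℝ :=
  ∑ t ∈ Finset.range n,
    condMutualInfo fun (a : Fin (t + 1) → X) (b : Y) (c : Fin (t + 1) → Y) =>
      ch.jointLaw P₀ π (t + 1) a (Fin.snoc (α := fun _ => Y) c b)

/-- The largest normalized directed information `(1/n) I(X^n → Y^n)` over all channel input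
distributions. -/
def maxDirectedInfo (ch : NOSTChannel X Y) (P₀ : Y → ℝ) (n : ℕ) : ℝ :=
  sSup {r : ℝ | ∃ π : InputDist X Y, IsInputDist π ∧ r = ch.directedInfo P₀ π n / n}

/-! ### The single-letter problem -/

/-- `I(X ; Y | Y')` when `(X, Y')` has distribution `P` and `Y` is the channel output. -/
def singleLetterInfo (ch : NOSTChannel X Y) (P : X × Y → ℝ) : ℝ :=
  condMutualInfo fun (x : X) (y : Y) (y' : Y) => P (x, y') * ch.Q x y' y

/-- The distributions of `(X, Y')` such that `P_Y = P_{Y'}`. -/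
def feasible (ch : NOSTChannel X Y) : Set (X × Y → ℝ) :=
  {P | P ∈ stdSimplex ℝ (X × Y) ∧
    ∀ y : Y, ∑ x, ∑ y', P (x, y') * ch.Q x y' y = ∑ x, P (x, y)}

end NOSTChannel

end

noncomputable section

/-! ### Relative entropy inequalities -/

/-! Fix a positive transition kernel `r` on the outputs and compare the true output law with the
Markov chain driven by `r`. The relative entropy this produces at one stage is `cost r P`, where `P`
is the law of the current input and the previous output. This cost is linear in `P`, and it equals
`singleLetterInfo P` when `r` is the output kernel that `P` itself induces.

By linearity, the costs of `n` stages add up to `n` times the cost of the time average of the stage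
laws. Choosing `r` as the output kernel of that average turns the total into `n` times its
single-letter information (`exists_cost_eq_singleLetterInfo`). The output law of each stage is the
previous-output marginal of the next, so the constraint `P_Y = P_{Y'}` telescopes and the average
violates it by at most `1 / n` (`IsOccupation.abs_defect_le`). Continuity of the information and
compactness of the simplex then bound the total by `n * (Cmax + δ)` for large `n`, uniformly over
strategies (`eventually_exists_sum_cost_le`).

Two inequalities connect this with the two notions of capacity. Each term of the directed
information is at most the cost of its stage, by the variational bound
`condMutualInfo_le_of_kernel`. For a code, `(1 - ε) log M` is at most the total cost plus `log 2`,
by the Fano-type inequality `log_card_le_sum_codeLaw_mul_logRatio`. -/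

theorem sub_le_mul_log_sub_log {p q : ℝ} (hp : 0 ≤ p) (hq : 0 ≤ q) (h : q = 0 → p = 0) :
    p - q ≤ p * (Real.log p - Real.log q) := by
  rcases hp.eq_or_lt with rfl | hp
  · simpa using hq
  have hq : 0 < q := lt_of_le_of_ne hq fun h0 => hp.ne' (h h0.symm)
  -- This is `log x ≤ x - 1` at `x = q / p`, to be multiplied by `p`.
  have h1 := Real.log_le_sub_one_of_pos (div_pos hq hp)
  rw [Real.log_div hq.ne' hp.ne'] at h1
  have h2 := mul_le_mul_of_nonneg_left h1 hp.le
  have h3 : p * (q / p - 1) = q - p := by field_simp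
  linarith

/-- Relative entropy of two probability vectors is nonnegative. -/
theorem sum_mul_log_div_nonneg {B : Type*} [Fintype B] {k r : B → ℝ} (hk : ∀ b, 0 < k b)
    (hr : ∀ b, 0 < r b) (hks : ∑ b, k b = 1) (hrs : ∑ b, r b = 1) :
    0 ≤ ∑ b, k b * Real.log (k b / r b) := by
  have h : ∑ b, (k b - r b) ≤ ∑ b, k b * Real.log (k b / r b) := by
    refine Finset.sum_le_sum fun b _ => ?_
    rw [Real.log_div (hk b).ne' (hr b).ne']
    exact sub_le_mul_log_sub_log (hk b).le (hr b).le fun h => absurd h (hr b).ne'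
  rwa [Finset.sum_sub_distrib, hks, hrs, sub_self] at h

/-! ### Conditional mutual information of a law disintegrated by a positive kernel -/

section Kernel

variable {A B C : Type*} [Fintype A] {m : A → C → ℝ} {κ : A → C → B → ℝ}

theorem sum_mul_kernel_pos (hm : ∀ a c, 0 ≤ m a c) (hκ : ∀ a c b, 0 < κ a c b) {a : A} {c : C}
    (h : 0 < m a c) (b : B) : 0 < ∑ a', m a' c * κ a' c b :=
  Finset.sum_pos' (fun a' _ => mul_nonneg (hm a' c) (hκ a' c b).le)
    ⟨a, Finset.mem_univ a, mul_pos h (hκ a c b)⟩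

/-- The conditional law of `B` given `C` under the law `m a c * κ a c b`, completed by the
kernel `κ a₀` on the null set. -/
def condKernel (m : A → C → ℝ) (κ : A → C → B → ℝ) (a₀ : A) (c : C) (b : B) : ℝ :=
  open scoped Classical in
  if ∑ a, m a c = 0 then κ a₀ c b else (∑ a, m a c * κ a c b) / ∑ a, m a c

theorem condKernel_pos (hm : ∀ a c, 0 ≤ m a c) (hκ : ∀ a c b, 0 < κ a c b) (a₀ : A) (c : C)
    (b : B) : 0 < condKernel m κ a₀ c b := by
  unfold condKernel
  split_ifs with h
  · exact hκ a₀ c b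
  · have hM : 0 < ∑ a, m a c :=
      lt_of_le_of_ne (Finset.sum_nonneg fun a _ => hm a c) (Ne.symm h)
    obtain ⟨a, -, ha⟩ := (Finset.sum_pos_iff_of_nonneg fun a _ => hm a c).1 hM
    exact div_pos (sum_mul_kernel_pos hm hκ ha b) hM

/-- The product form needs no case distinction: on the null set every `m a c` vanishes, so both
sides are zero. -/
theorem sum_mul_condKernel (hm : ∀ a c, 0 ≤ m a c) (a₀ : A) (c : C) (b : B) :
    (∑ a, m a c) * condKernel m κ a₀ c b = ∑ a, m a c * κ a c b := by
  unfold condKernel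
  split_ifs with h
  · rw [h, zero_mul]
    rw [Finset.sum_eq_zero_iff_of_nonneg fun a _ => hm a c] at h
    exact (Finset.sum_eq_zero fun a ha => by rw [h a ha, zero_mul]).symm
  · exact mul_div_cancel₀ _ h

variable [Fintype B]

theorem sum_condKernel (hκs : ∀ a c, ∑ b, κ a c b = 1) (a₀ : A) (c : C) :
    ∑ b, condKernel m κ a₀ c b = 1 := by
  unfold condKernel
  split_ifs with h
  · exact hκs a₀ c
  · rw [← Finset.sum_div, Finset.sum_comm]
    simp only [← Finset.mul_sum, hκs, mul_one]
    exact div_self h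

variable [Fintype C]

/-- Conditional mutual information of a law that is disintegrated as `m a c * κ a c b`. -/
theorem condMutualInfo_mul_kernel (hm : ∀ a c, 0 ≤ m a c) (hκ : ∀ a c b, 0 < κ a c b)
    (hκs : ∀ a c, ∑ b, κ a c b = 1) :
    condMutualInfo (fun a b c => m a c * κ a c b) =
      ∑ a, ∑ b, ∑ c, m a c * κ a c b * (Real.log (κ a c b) + Real.log (∑ a', m a' c) -
        Real.log (∑ a', m a' c * κ a' c b)) := by
  unfold condMutualInfo
  refine Finset.sum_congr rfl fun a _ => Finset.sum_congr rfl fun b _ =>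
    Finset.sum_congr rfl fun c _ => ?_
  simp only [← Finset.mul_sum, hκs, mul_one]
  rcases (hm a c).eq_or_lt with h | h
  · simp [← h]
  have hM : 0 < ∑ a', m a' c :=
    Finset.sum_pos' (fun a' _ => hm a' c) ⟨a, Finset.mem_univ a, h⟩
  have hN := sum_mul_kernel_pos hm hκ h b
  congr 1
  -- The weight `m a c` cancels in the ratio, leaving only positive quantities under the logarithms.
  rw [mul_assoc, mul_div_mul_left _ _ h.ne', Real.log_div (by have := hκ a c b; positivity) hN.ne',
    Real.log_mul (hκ a c b).ne' hM.ne']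

/-- The equality case of the variational bound: `h` says that `ρ` is a version of the conditional
law of `B` given `C`. -/
theorem condMutualInfo_eq_of_marginal {ρ : C → B → ℝ} (hm : ∀ a c, 0 ≤ m a c)
    (hκ : ∀ a c b, 0 < κ a c b) (hκs : ∀ a c, ∑ b, κ a c b = 1) (hρ : ∀ c b, 0 < ρ c b)
    (h : ∀ c b, (∑ a, m a c) * ρ c b = ∑ a, m a c * κ a c b) :
    condMutualInfo (fun a b c => m a c * κ a c b) =
      ∑ a, ∑ b, ∑ c, m a c * κ a c b * Real.log (κ a c b / ρ c b) := by
  rw [condMutualInfo_mul_kernel hm hκ hκs]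
  refine Finset.sum_congr rfl fun a _ => Finset.sum_congr rfl fun b _ =>
    Finset.sum_congr rfl fun c _ => ?_
  rcases (hm a c).eq_or_lt with h0 | h0
  · simp [← h0]
  have hM : 0 < ∑ a', m a' c :=
    Finset.sum_pos' (fun a' _ => hm a' c) ⟨a, Finset.mem_univ a, h0⟩
  rw [← h, Real.log_mul hM.ne' (hρ c b).ne', Real.log_div (hκ a c b).ne' (hρ c b).ne']
  ring

/-- The variational upper bound on conditional mutual information by a reference kernel `ρ`. -/
theorem condMutualInfo_le_of_kernel {ρ : C → B → ℝ} (hm : ∀ a c, 0 ≤ m a c)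
    (hκ : ∀ a c b, 0 < κ a c b) (hκs : ∀ a c, ∑ b, κ a c b = 1) (hρ : ∀ c b, 0 < ρ c b)
    (hρs : ∀ c, ∑ b, ρ c b = 1) :
    condMutualInfo (fun a b c => m a c * κ a c b) ≤
      ∑ a, ∑ b, ∑ c, m a c * κ a c b * Real.log (κ a c b / ρ c b) := by
  rw [condMutualInfo_mul_kernel hm hκ hκs, ← sub_nonneg]
  -- The gap in the bound is the relative entropy of the true law of `(C, B)` with respect to the
  -- law with the same `C`-marginal and kernel `ρ`.
  have key : ∑ c, ∑ b, (∑ a, m a c * κ a c b) * (Real.log (∑ a, m a c * κ a c b) -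
      Real.log ((∑ a, m a c) * ρ c b)) =
      ∑ a, ∑ b, ∑ c, m a c * κ a c b * Real.log (κ a c b / ρ c b) -
      ∑ a, ∑ b, ∑ c, m a c * κ a c b * (Real.log (κ a c b) + Real.log (∑ a', m a' c) -
        Real.log (∑ a', m a' c * κ a' c b)) := by
    simp only [← Finset.sum_sub_distrib]
    rw [Finset.sum_comm, Finset.sum_comm (s := (Finset.univ : Finset A))]
    refine Finset.sum_congr rfl fun b _ => ?_
    rw [Finset.sum_comm (s := (Finset.univ : Finset A))]
    refine Finset.sum_congr rfl fun c _ => ?_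
    rw [Finset.sum_mul]
    refine Finset.sum_congr rfl fun a _ => ?_
    rcases (hm a c).eq_or_lt with h0 | h0
    · simp [← h0]
    have hM : 0 < ∑ a', m a' c :=
      Finset.sum_pos' (fun a' _ => hm a' c) ⟨a, Finset.mem_univ a, h0⟩
    rw [Real.log_mul hM.ne' (hρ c b).ne', Real.log_div (hκ a c b).ne' (hρ c b).ne']
    ring
  rw [← key]
  refine Finset.sum_nonneg fun c _ => ?_
  have hM : 0 ≤ ∑ a, m a c := Finset.sum_nonneg fun a _ => hm a c
  have h : ∑ b, (∑ a, m a c * κ a c b - (∑ a, m a c) * ρ c b) ≤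
      ∑ b, (∑ a, m a c * κ a c b) * (Real.log (∑ a, m a c * κ a c b) -
      Real.log ((∑ a, m a c) * ρ c b)) := by
    refine Finset.sum_le_sum fun b _ => sub_le_mul_log_sub_log
      (Finset.sum_nonneg fun a _ => mul_nonneg (hm a c) (hκ a c b).le)
      (mul_nonneg hM (hρ c b).le) fun h0 => ?_
    have h1 : ∑ a, m a c = 0 := (mul_eq_zero.1 h0).resolve_right (hρ c b).ne'
    rw [Finset.sum_eq_zero_iff_of_nonneg fun a _ => hm a c] at h1
    exact Finset.sum_eq_zero fun a ha => by rw [h1 a ha, zero_mul]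
  refine le_trans (le_of_eq ?_) h
  rw [Finset.sum_sub_distrib, Finset.sum_comm, ← Finset.mul_sum, hρs]
  simp only [← Finset.mul_sum, hκs, mul_one, sub_self]

theorem condMutualInfo_mul_kernel_nonneg (hm : ∀ a c, 0 ≤ m a c)
    (hκ : ∀ a c b, 0 < κ a c b) (hκs : ∀ a c, ∑ b, κ a c b = 1) :
    0 ≤ condMutualInfo (fun a b c => m a c * κ a c b) := by
  rcases isEmpty_or_nonempty A with hA | ⟨⟨a₀⟩⟩
  · simp [condMutualInfo]
  rw [condMutualInfo_eq_of_marginal hm hκ hκs (condKernel_pos hm hκ a₀)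
    (sum_mul_condKernel hm a₀)]
  refine Finset.sum_nonneg fun a _ => ?_
  rw [Finset.sum_comm]
  refine Finset.sum_nonneg fun c _ => ?_
  simp only [mul_assoc, ← Finset.mul_sum]
  exact mul_nonneg (hm a c) (sum_mul_log_div_nonneg (hκ a c) (condKernel_pos hm hκ a₀ c)
    (hκs a c) (sum_condKernel hκs a₀ c))

end Kernel

/-! ### Extending words by one letter -/

theorem sum_fin_succ_eq_sum_snoc {α : Type*} [Fintype α] {n : ℕ} (F : (Fin (n + 1) → α) → ℝ) :
    ∑ y, F y = ∑ y : Fin n → α, ∑ b, F (Fin.snoc (α := fun _ => α) y b) := by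
  rw [← (Fin.snocEquiv fun _ : Fin (n + 1) => α).sum_comp, Fintype.sum_prod_type_right]
  rfl

theorem snoc_mk {α : Type*} {n : ℕ} (y : Fin n → α) (b : α) {i : ℕ} (h : i < n)
    (h' : i < n + 1) : Fin.snoc (α := fun _ => α) y b ⟨i, h'⟩ = y ⟨i, h⟩ :=
  Fin.snoc_castSucc (α := fun _ => α) b y ⟨i, h⟩

namespace NOSTChannel

variable {X Y : Type*} [Fintype X] [Fintype Y]

/-! ### The single-letter problem: continuity and compactness -/

/-- A linear term plus a difference of entropies. No quotient is left and `negMulLog` is continuous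
at zero, so continuity up to the boundary of the simplex can be read off. -/
theorem singleLetterInfo_eq (ch : NOSTChannel X Y) {P : X × Y → ℝ} (hP : ∀ z, 0 ≤ P z) :
    ch.singleLetterInfo P = ∑ x, ∑ y, ∑ y', P (x, y') * ch.Q x y' y * Real.log (ch.Q x y' y) -
      ∑ y', Real.negMulLog (∑ x, P (x, y')) +
      ∑ y', ∑ y, Real.negMulLog (∑ x, P (x, y') * ch.Q x y' y) := by
  have h := condMutualInfo_mul_kernel (m := fun x y' => P (x, y')) (κ := ch.Q)
    (fun _ _ => hP _) ch.pos ch.sum_eq_one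
  have h1 : ∑ x, ∑ y, ∑ y', P (x, y') * ch.Q x y' y * Real.log (∑ x', P (x', y')) =
      - ∑ y', Real.negMulLog (∑ x, P (x, y')) := by
    rw [← Finset.sum_neg_distrib]
    simp only [Real.negMulLog, neg_mul, neg_neg, Finset.sum_mul]
    rw [Finset.sum_comm (s := (Finset.univ : Finset Y)) (t := (Finset.univ : Finset X))]
    refine Finset.sum_congr rfl fun x _ => ?_
    rw [Finset.sum_comm]
    simp only [← Finset.sum_mul, ← Finset.mul_sum, ch.sum_eq_one, mul_one]
  have h2 : ∑ x, ∑ y, ∑ y', P (x, y') * ch.Q x y' y *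
      Real.log (∑ x', P (x', y') * ch.Q x' y' y) =
      - ∑ y', ∑ y, Real.negMulLog (∑ x, P (x, y') * ch.Q x y' y) := by
    simp only [← Finset.sum_neg_distrib]
    simp only [Real.negMulLog, neg_mul, neg_neg, Finset.sum_mul]
    rw [Finset.sum_comm,
      Finset.sum_comm (s := (Finset.univ : Finset Y)) (t := (Finset.univ : Finset Y))]
    exact Finset.sum_congr rfl fun y _ => Finset.sum_comm
  unfold singleLetterInfo
  rw [h]
  simp only [mul_add, mul_sub, Finset.sum_add_distrib, Finset.sum_sub_distrib]
  rw [h1, h2]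
  ring

theorem continuousOn_singleLetterInfo (ch : NOSTChannel X Y) :
    ContinuousOn ch.singleLetterInfo (stdSimplex ℝ (X × Y)) := by
  refine ContinuousOn.congr (Continuous.continuousOn ?_)
    fun P hP => ch.singleLetterInfo_eq fun z => hP.1 z
  have := Real.continuous_negMulLog
  fun_prop

theorem singleLetterInfo_nonneg (ch : NOSTChannel X Y) {P : X × Y → ℝ}
    (hP : P ∈ stdSimplex ℝ (X × Y)) : 0 ≤ ch.singleLetterInfo P :=
  condMutualInfo_mul_kernel_nonneg (m := fun x y' => P (x, y')) (κ := ch.Q)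
    (fun _ _ => hP.1 _) ch.pos ch.sum_eq_one

/-- `P_Y(y) - P_{Y'}(y)`, the violation of the stationarity constraint at `y`. -/
def defect (ch : NOSTChannel X Y) (P : X × Y → ℝ) (y : Y) : ℝ :=
  ∑ x, ∑ y', P (x, y') * ch.Q x y' y - ∑ x, P (x, y)

theorem continuous_defect (ch : NOSTChannel X Y) (y : Y) :
    Continuous fun P => ch.defect P y := by
  unfold defect
  fun_prop

theorem mem_feasible_iff (ch : NOSTChannel X Y) {P : X × Y → ℝ} :
    P ∈ ch.feasible ↔ P ∈ stdSimplex ℝ (X × Y) ∧ ∀ y, ch.defect P y = 0 := by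
  simp only [feasible, defect, sub_eq_zero, Set.mem_ofPred_eq]

/-- A limit of almost feasible laws is feasible. -/
theorem exists_feasible_of_forall_almost (ch : NOSTChannel X Y) (c : ℝ)
    (h : ∀ η > 0, ∃ P ∈ stdSimplex ℝ (X × Y), (∀ y, |ch.defect P y| ≤ η) ∧
      c ≤ ch.singleLetterInfo P) :
    ∃ P ∈ ch.feasible, c ≤ ch.singleLetterInfo P := by
  choose! P hPs hPd hPc using h
  have hu : ∀ n : ℕ, (0 : ℝ) < 1 / (n + 1) := fun n => Nat.one_div_pos_of_nat
  obtain ⟨R, hR, φ, hφ, hlim⟩ := (isCompact_stdSimplex ℝ (X × Y)).tendsto_subseq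
    (x := fun n : ℕ => P (1 / (n + 1))) fun n => hPs _ (hu n)
  refine ⟨R, ch.mem_feasible_iff.2 ⟨hR, fun y => ?_⟩, ?_⟩
  · have h1 := (((ch.continuous_defect y).tendsto R).comp hlim).abs
    have h2 : Tendsto (fun n => 1 / ((φ n : ℝ) + 1)) atTop (𝓝 0) :=
      (tendsto_one_div_add_atTop_nhds_zero_nat (𝕜 := ℝ)).comp hφ.tendsto_atTop
    exact abs_nonpos_iff.1 (le_of_tendsto_of_tendsto' h1 h2 fun n => hPd _ (hu _) y)
  · have h1 : Tendsto (fun n => P (1 / ((φ n : ℝ) + 1))) atTop (𝓝[stdSimplex ℝ (X × Y)] R) :=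
      tendsto_nhdsWithin_iff.2 ⟨hlim, Eventually.of_forall fun n => hPs _ (hu _)⟩
    exact ge_of_tendsto' ((ch.continuousOn_singleLetterInfo R hR).tendsto.comp h1)
      fun n => hPc _ (hu _)

theorem isCompact_feasible (ch : NOSTChannel X Y) : IsCompact ch.feasible := by
  have : ch.feasible = stdSimplex ℝ (X × Y) ∩ ⋂ y, {P | ch.defect P y = 0} := by
    ext P
    simp [mem_feasible_iff]
  rw [this]
  exact (isCompact_stdSimplex ℝ (X × Y)).inter_right
    (isClosed_iInter fun y => isClosed_eq (ch.continuous_defect y) continuous_const)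

theorem exists_isGreatest_of_nonempty (ch : NOSTChannel X Y) (h : ch.feasible.Nonempty) :
    ∃ Cmax, IsGreatest (ch.singleLetterInfo '' ch.feasible) Cmax :=
  (ch.isCompact_feasible.image_of_continuousOn
    (ch.continuousOn_singleLetterInfo.mono fun _ hP => hP.1)).exists_isGreatest (h.image _)

/-- Almost feasible laws have single-letter information almost bounded by the maximum. -/
theorem exists_defect_bound (ch : NOSTChannel X Y) {Cmax δ : ℝ}
    (hC : IsGreatest (ch.singleLetterInfo '' ch.feasible) Cmax) (hδ : 0 < δ) :
    ∃ η > 0, ∀ P ∈ stdSimplex ℝ (X × Y), (∀ y, |ch.defect P y| ≤ η) →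
      ch.singleLetterInfo P ≤ Cmax + δ := by
  by_contra! hcon
  obtain ⟨P, hP, hle⟩ := ch.exists_feasible_of_forall_almost (Cmax + δ) fun η hη => by
    obtain ⟨P, h1, h2, h3⟩ := hcon η hη
    exact ⟨P, h1, h2, h3.le⟩
  have := hC.2 ⟨P, hP, rfl⟩
  linarith

/-! ### Sequences of laws of `(X_t, Y_{t-1})` -/

/-- The average over `(X, Y') ∼ P` of the relative entropy of the channel law with respect to the
kernel `r`. -/
def cost (ch : NOSTChannel X Y) (r : Y → Y → ℝ) (P : X × Y → ℝ) : ℝ :=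
  ∑ z : X × Y, P z * ∑ y, ch.Q z.1 z.2 y * Real.log (ch.Q z.1 z.2 y / r z.2 y)

/-- `P t` is a possible sequence of laws of `(X_{t+1}, Y_t)`: the law of the output at a stage is
the marginal of the next stage. -/
structure IsOccupation (ch : NOSTChannel X Y) (P : ℕ → X × Y → ℝ) : Prop where
  mem : ∀ t, P t ∈ stdSimplex ℝ (X × Y)
  marginal : ∀ t y, ∑ x, P (t + 1) (x, y) = ∑ x, ∑ y', P t (x, y') * ch.Q x y' y

/-- The time average of the first `n` laws. -/
def timeAverage (P : ℕ → X × Y → ℝ) (n : ℕ) (z : X × Y) : ℝ :=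
  (∑ t ∈ Finset.range n, P t z) / n

theorem IsOccupation.timeAverage_mem {ch : NOSTChannel X Y} {P : ℕ → X × Y → ℝ}
    (hP : ch.IsOccupation P) {n : ℕ} (hn : n ≠ 0) :
    timeAverage P n ∈ stdSimplex ℝ (X × Y) := by
  refine ⟨fun z => div_nonneg (Finset.sum_nonneg fun t _ => (hP.mem t).1 z) n.cast_nonneg, ?_⟩
  unfold timeAverage
  rw [← Finset.sum_div, Finset.sum_comm]
  simp only [(hP.mem _).2, Finset.sum_const, Finset.card_range, nsmul_eq_mul, mul_one]
  exact div_self (Nat.cast_ne_zero.2 hn)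

theorem marginal_mem_Icc {P : X × Y → ℝ} (hP : P ∈ stdSimplex ℝ (X × Y)) (y : Y) :
    ∑ x, P (x, y) ∈ Set.Icc (0 : ℝ) 1 := by
  refine ⟨Finset.sum_nonneg fun x _ => hP.1 _, ?_⟩
  rw [← hP.2, Fintype.sum_prod_type_right]
  exact Finset.single_le_sum (f := fun y => ∑ x, P (x, y))
    (fun y _ => Finset.sum_nonneg fun x _ => hP.1 _) (Finset.mem_univ y)

/-- The defects of the first `n` laws telescope to the difference of two marginal probabilities, at
times `n` and `0`, both in `[0, 1]`. -/
theorem IsOccupation.abs_defect_le {ch : NOSTChannel X Y} {P : ℕ → X × Y → ℝ}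
    (hP : ch.IsOccupation P) {n : ℕ} (hn : n ≠ 0) (y : Y) :
    |ch.defect (timeAverage P n) y| ≤ 1 / n := by
  have h : ch.defect (timeAverage P n) y = (∑ x, P n (x, y) - ∑ x, P 0 (x, y)) / n := by
    rw [← Finset.sum_range_sub (fun t => ∑ x, P t (x, y))]
    simp only [hP.marginal]
    rw [Finset.sum_sub_distrib, sub_div]
    unfold defect timeAverage
    congr 1
    · simp only [div_mul_eq_mul_div, ← Finset.sum_div, Finset.sum_mul]
      congr 1
      rw [Finset.sum_comm (s := Finset.range n)]
      exact Finset.sum_congr rfl fun x _ => Finset.sum_comm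
    · rw [← Finset.sum_div, Finset.sum_comm]
  have h0 := marginal_mem_Icc (hP.mem 0) y
  have h1 := marginal_mem_Icc (hP.mem n) y
  rw [h, abs_div, Nat.abs_cast]
  gcongr
  rw [abs_le]
  constructor <;> linarith [h0.1, h0.2, h1.1, h1.2]

theorem sum_cost_eq (ch : NOSTChannel X Y) (r : Y → Y → ℝ) (P : ℕ → X × Y → ℝ) {n : ℕ}
    (hn : n ≠ 0) :
    ∑ t ∈ Finset.range n, ch.cost r (P t) = n * ch.cost r (timeAverage P n) := by
  have hn' : (n : ℝ) ≠ 0 := Nat.cast_ne_zero.2 hn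
  unfold cost timeAverage
  rw [Finset.sum_comm, Finset.mul_sum]
  refine Finset.sum_congr rfl fun z _ => ?_
  rw [← Finset.sum_mul, ← mul_assoc, mul_div_cancel₀ _ hn']

/-- The kernel is the output law given the previous output under `P`. An arbitrary input letter
defines it on previous outputs of probability zero, which keeps it positive everywhere. -/
theorem exists_cost_eq_singleLetterInfo [Nonempty X] (ch : NOSTChannel X Y) {P : X × Y → ℝ}
    (hP : P ∈ stdSimplex ℝ (X × Y)) :
    ∃ r : Y → Y → ℝ, (∀ y' y, 0 < r y' y) ∧ (∀ y', ∑ y, r y' y = 1) ∧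
      ch.cost r P = ch.singleLetterInfo P := by
  have hm : ∀ x y', 0 ≤ P (x, y') := fun _ _ => hP.1 _
  let r := condKernel (fun x y' => P (x, y')) ch.Q (Classical.arbitrary X)
  refine ⟨r, condKernel_pos hm ch.pos _, sum_condKernel ch.sum_eq_one _, ?_⟩
  unfold singleLetterInfo cost
  rw [condMutualInfo_eq_of_marginal (m := fun x y' => P (x, y')) (κ := ch.Q) (ρ := r) hm ch.pos
    ch.sum_eq_one (condKernel_pos hm ch.pos _) (sum_mul_condKernel hm _), Fintype.sum_prod_type]
  refine Finset.sum_congr rfl fun x _ => ?_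
  rw [Finset.sum_comm]
  simp only [Finset.mul_sum, mul_assoc]

/-- For long horizons, some reference kernel has total cost at most `n * (Cmax + δ)`. -/
theorem eventually_exists_sum_cost_le [Nonempty X] (ch : NOSTChannel X Y) {Cmax δ : ℝ}
    (hC : IsGreatest (ch.singleLetterInfo '' ch.feasible) Cmax) (hδ : 0 < δ) :
    ∀ᶠ n : ℕ in atTop, ∀ P, ch.IsOccupation P → ∃ r : Y → Y → ℝ, (∀ y' y, 0 < r y' y) ∧
      (∀ y', ∑ y, r y' y = 1) ∧ ∑ t ∈ Finset.range n, ch.cost r (P t) ≤ n * (Cmax + δ) := by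
  -- Neither `η` nor the defect bound `1 / n` depends on `P`, so one threshold on `n` serves all
  -- occupation sequences; only `r` varies with `P`.
  obtain ⟨η, hη, hb⟩ := ch.exists_defect_bound hC hδ
  filter_upwards [eventually_ne_atTop 0,
    (tendsto_one_div_atTop_nhds_zero_nat (𝕜 := ℝ)).eventually_le_const hη] with n hn hle P hP
  obtain ⟨r, h1, h2, h3⟩ := ch.exists_cost_eq_singleLetterInfo (hP.timeAverage_mem hn)
  refine ⟨r, h1, h2, ?_⟩
  rw [ch.sum_cost_eq r P hn, h3]
  gcongr
  exact hb _ (hP.timeAverage_mem hn) fun y => (hP.abs_defect_le hn y).trans hle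

/-- A Krylov–Bogoliubov argument: limit points of the time averages are stationary. The bound `0` on
the information is a placeholder. -/
theorem IsOccupation.nonempty_feasible {ch : NOSTChannel X Y} {P : ℕ → X × Y → ℝ}
    (hP : ch.IsOccupation P) : ch.feasible.Nonempty := by
  obtain ⟨R, hR, -⟩ := ch.exists_feasible_of_forall_almost 0 fun η hη => by
    obtain ⟨n, hn⟩ := exists_nat_one_div_lt hη
    refine ⟨timeAverage P (n + 1), hP.timeAverage_mem n.succ_ne_zero, fun y => ?_,
      ch.singleLetterInfo_nonneg (hP.timeAverage_mem n.succ_ne_zero)⟩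
    have := hP.abs_defect_le n.succ_ne_zero y
    push_cast at this
    exact this.trans hn.le
  exact ⟨R, hR⟩

/-- The law of `(ξ, ζ)` under the weights `m`. -/
def pairLaw {S : Type*} [Fintype S] (m : S → ℝ) (ξ : S → X) (ζ : S → Y) (z : X × Y) : ℝ :=
  open scoped Classical in ∑ s, if (ξ s, ζ s) = z then m s else 0

theorem sum_pairLaw_mul {S : Type*} [Fintype S] (m : S → ℝ) (ξ : S → X) (ζ : S → Y)
    (φ : X × Y → ℝ) : ∑ z, pairLaw m ξ ζ z * φ z = ∑ s, m s * φ (ξ s, ζ s) := by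
  classical
  simp only [pairLaw, Finset.sum_mul]
  rw [Finset.sum_comm]
  simp

theorem pairLaw_mem_stdSimplex {S : Type*} [Fintype S] {m : S → ℝ} (ξ : S → X) (ζ : S → Y)
    (hm : ∀ s, 0 ≤ m s) (hs : ∑ s, m s = 1) : pairLaw m ξ ζ ∈ stdSimplex ℝ (X × Y) := by
  refine ⟨fun z => Finset.sum_nonneg fun s _ => ?_, ?_⟩
  · split_ifs
    exacts [hm s, le_rfl]
  · simpa [hs] using sum_pairLaw_mul m ξ ζ fun _ => 1

theorem sum_pairLaw_eq {S : Type*} [Fintype S] [DecidableEq Y] (m : S → ℝ) (ξ : S → X)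
    (ζ : S → Y) (y : Y) : ∑ x, pairLaw m ξ ζ (x, y) = ∑ s, if ζ s = y then m s else 0 := by
  have h := sum_pairLaw_mul m ξ ζ fun z => if z.2 = y then 1 else 0
  rw [Fintype.sum_prod_type] at h
  simpa using h

end NOSTChannel

namespace NOSTChannel

variable {X Y : Type*} [Fintype Y]

/-! ### Input distributions -/

section Joint

variable (ch : NOSTChannel X Y) (P₀ : Y → ℝ) (π : InputDist X Y)

theorem jointLaw_snoc (n : ℕ) (a : Fin n → X) (c : Fin (n + 1) → Y) (x : X) (y : Y) :
    ch.jointLaw P₀ π (n + 1) (Fin.snoc (α := fun _ => X) a x) (Fin.snoc (α := fun _ => Y) c y) =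
      ch.jointLaw P₀ π n a c * π n a c x * ch.Q x (c (Fin.last n)) y := by
  unfold jointLaw
  rw [Fin.prod_univ_castSucc]
  have h0 : Fin.snoc (α := fun _ => Y) c y 0 = c 0 := snoc_mk c y (Nat.succ_pos n) _
  have h1 : ∀ t : Fin n,
      π t.castSucc (fun i : Fin t.castSucc => Fin.snoc (α := fun _ => X) a x ⟨i, by grind⟩)
        (fun i : Fin (t.castSucc + 1) => Fin.snoc (α := fun _ => Y) c y ⟨i, by grind⟩)
        (Fin.snoc (α := fun _ => X) a x t.castSucc) *
      ch.Q (Fin.snoc (α := fun _ => X) a x t.castSucc)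
        (Fin.snoc (α := fun _ => Y) c y t.castSucc.castSucc)
        (Fin.snoc (α := fun _ => Y) c y t.castSucc.succ) =
      π t (fun i : Fin t => a ⟨i, by omega⟩) (fun i : Fin (t + 1) => c ⟨i, by omega⟩) (a t) *
        ch.Q (a t) (c t.castSucc) (c t.succ) := by
    intro t
    rw [← Fin.castSucc_succ]
    simp only [Fin.snoc_castSucc]
    congr 2
    · funext i
      exact snoc_mk a x _ _
    · funext i
      exact snoc_mk c y _ _
  have h2 : π (Fin.last n) (fun i : Fin (Fin.last n) => Fin.snoc (α := fun _ => X) a x ⟨i, by grind⟩)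
        (fun i : Fin (Fin.last n + 1) => Fin.snoc (α := fun _ => Y) c y ⟨i, by grind⟩)
        (Fin.snoc (α := fun _ => X) a x (Fin.last n)) = π n a c x := by
    rw [Fin.snoc_last]
    have e1 : (fun i : Fin n => Fin.snoc (α := fun _ => X) a x ⟨i, by omega⟩) = a :=
      funext fun i => snoc_mk a x _ _
    have e2 : (fun i : Fin (n + 1) => Fin.snoc (α := fun _ => Y) c y ⟨i, by omega⟩) = c :=
      funext fun i => snoc_mk c y _ _
    -- The value of `Fin.last n` occurs in the types of both words; it is `n` by unfolding, so the
    -- equalities are stated at `n` and transported.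
    exact congrArg₂ (fun u v => π n u v x) e1 e2
  rw [h0, h2, Finset.prod_congr rfl fun t _ => h1 t, Fin.snoc_last, Fin.snoc_castSucc,
    Fin.succ_last, Fin.snoc_last]
  ring

/-- The law of `(X_1, …, X_{n+1})` and `(Y_0, …, Y_n)`. -/
def inputLaw (n : ℕ) (s : (Fin (n + 1) → X) × (Fin (n + 1) → Y)) : ℝ :=
  ch.jointLaw P₀ π n (fun i => s.1 i.castSucc) s.2 *
    π n (fun i => s.1 i.castSucc) s.2 (s.1 (Fin.last n))

/-- This is the disintegration that the kernel lemmas require, with a kernel that reads only the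
last input and the last output. -/
theorem jointLaw_succ_snoc (n : ℕ) (a : Fin (n + 1) → X) (c : Fin (n + 1) → Y) (y : Y) :
    ch.jointLaw P₀ π (n + 1) a (Fin.snoc (α := fun _ => Y) c y) =
      ch.inputLaw P₀ π n (a, c) * ch.Q (a (Fin.last n)) (c (Fin.last n)) y := by
  have h : a = Fin.snoc (α := fun _ => X) (fun i => a i.castSucc) (a (Fin.last n)) :=
    (Fin.snoc_init_self (α := fun _ => X) a).symm
  conv_lhs => rw [h]
  rw [jointLaw_snoc]
  rfl

variable [Fintype X]

theorem jointLaw_nonneg (hP₀ : P₀ ∈ stdSimplex ℝ Y) (hπ : IsInputDist π) (n : ℕ) (a : Fin n → X)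
    (c : Fin (n + 1) → Y) : 0 ≤ ch.jointLaw P₀ π n a c :=
  mul_nonneg (hP₀.1 _) (Finset.prod_nonneg fun _ _ =>
    mul_nonneg ((hπ _ _ _).1 _) (ch.pos _ _ _).le)

variable {P₀ π}

theorem inputLaw_nonneg (hP₀ : P₀ ∈ stdSimplex ℝ Y) (hπ : IsInputDist π) (n : ℕ)
    (s : (Fin (n + 1) → X) × (Fin (n + 1) → Y)) : 0 ≤ ch.inputLaw P₀ π n s :=
  mul_nonneg (ch.jointLaw_nonneg P₀ π hP₀ hπ _ _ _) ((hπ _ _ _).1 _)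

/-- Integrates out the newest input. Together with `sum_jointLaw_succ_mul`, which integrates out the
newest output, it gives the marginal recursion of `IsOccupation`. -/
theorem sum_inputLaw_mul (hπ : IsInputDist π) (n : ℕ) (φ : (Fin (n + 1) → Y) → ℝ) :
    ∑ s, ch.inputLaw P₀ π n s * φ s.2 = ∑ a, ∑ c, ch.jointLaw P₀ π n a c * φ c := by
  rw [Fintype.sum_prod_type, sum_fin_succ_eq_sum_snoc]
  refine Finset.sum_congr rfl fun a _ => ?_
  rw [Finset.sum_comm]
  refine Finset.sum_congr rfl fun c _ => ?_
  simp only [inputLaw, Fin.snoc_castSucc, Fin.snoc_last]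
  rw [← Finset.sum_mul, ← Finset.mul_sum, (hπ n a c).2, mul_one]

theorem sum_jointLaw_succ_mul (n : ℕ) (φ : Y → ℝ) :
    ∑ a, ∑ c, ch.jointLaw P₀ π (n + 1) a c * φ (c (Fin.last (n + 1))) =
      ∑ s, ch.inputLaw P₀ π n s *
        ∑ y, ch.Q (s.1 (Fin.last n)) (s.2 (Fin.last n)) y * φ y := by
  rw [Fintype.sum_prod_type]
  refine Finset.sum_congr rfl fun a _ => ?_
  rw [sum_fin_succ_eq_sum_snoc]
  refine Finset.sum_congr rfl fun c _ => ?_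
  simp only [jointLaw_succ_snoc, Fin.snoc_last, mul_assoc, Finset.mul_sum]

theorem sum_inputLaw (hP₀ : P₀ ∈ stdSimplex ℝ Y) (hπ : IsInputDist π) (n : ℕ) :
    ∑ s, ch.inputLaw P₀ π n s = 1 := by
  induction n with
  | zero =>
    have h := ch.sum_inputLaw_mul (P₀ := P₀) hπ 0 fun _ => 1
    simp only [mul_one] at h
    rw [h, Fintype.sum_unique, sum_fin_succ_eq_sum_snoc, Fintype.sum_unique]
    simpa [jointLaw, Fin.snoc] using hP₀.2
  | succ n ih =>
    have h := ch.sum_inputLaw_mul (P₀ := P₀) hπ (n + 1) fun _ => 1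
    have h' := ch.sum_jointLaw_succ_mul (P₀ := P₀) (π := π) n fun _ => 1
    simp only [mul_one, ch.sum_eq_one] at h h'
    rw [h, h', ih]

/-- The sequence of laws of `(X_{t+1}, Y_t)` under an input distribution. -/
theorem isOccupation_inputLaw (hP₀ : P₀ ∈ stdSimplex ℝ Y) (hπ : IsInputDist π) :
    ch.IsOccupation fun t => pairLaw (ch.inputLaw P₀ π t) (fun s => s.1 (Fin.last t))
      (fun s => s.2 (Fin.last t)) where
  mem t := pairLaw_mem_stdSimplex _ _ (ch.inputLaw_nonneg hP₀ hπ t) (ch.sum_inputLaw hP₀ hπ t)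
  marginal t y := by
    classical
    rw [sum_pairLaw_eq]
    have h := ch.sum_inputLaw_mul (P₀ := P₀) hπ (t + 1) fun c =>
      if c (Fin.last (t + 1)) = y then 1 else 0
    have h' := ch.sum_jointLaw_succ_mul (P₀ := P₀) (π := π) t fun y' => if y' = y then 1 else 0
    have h2 := sum_pairLaw_mul (ch.inputLaw P₀ π t) (fun s => s.1 (Fin.last t))
      (fun s => s.2 (Fin.last t)) fun z => ch.Q z.1 z.2 y
    rw [Fintype.sum_prod_type] at h2
    rw [h2]
    simpa using h.trans h'

/-- The reference kernel sees only the last output of the past, so the variational bound depends on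
the whole history only through the law of the last pair. -/
theorem condMutualInfo_jointLaw_le (hP₀ : P₀ ∈ stdSimplex ℝ Y) (hπ : IsInputDist π)
    {r : Y → Y → ℝ} (hr : ∀ y' y, 0 < r y' y) (hrs : ∀ y', ∑ y, r y' y = 1) (t : ℕ) :
    (condMutualInfo fun (a : Fin (t + 1) → X) (b : Y) (c : Fin (t + 1) → Y) =>
      ch.jointLaw P₀ π (t + 1) a (Fin.snoc (α := fun _ => Y) c b)) ≤
    ch.cost r (pairLaw (ch.inputLaw P₀ π t) (fun s => s.1 (Fin.last t))
      (fun s => s.2 (Fin.last t))) := by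
  simp only [jointLaw_succ_snoc]
  refine (condMutualInfo_le_of_kernel (m := fun a c => ch.inputLaw P₀ π t (a, c))
    (κ := fun a c b => ch.Q (a (Fin.last t)) (c (Fin.last t)) b)
    (ρ := fun c b => r (c (Fin.last t)) b) (fun _ _ => ch.inputLaw_nonneg hP₀ hπ _ _)
    (fun _ _ _ => ch.pos _ _ _) (fun _ _ => ch.sum_eq_one _ _) (fun _ _ => hr _ _)
    fun _ => hrs _).trans_eq ?_
  unfold cost
  rw [sum_pairLaw_mul, Fintype.sum_prod_type]
  refine Finset.sum_congr rfl fun a _ => ?_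
  rw [Finset.sum_comm]
  simp only [Finset.mul_sum, mul_assoc]

theorem directedInfo_le_sum_cost (hP₀ : P₀ ∈ stdSimplex ℝ Y) (hπ : IsInputDist π)
    {r : Y → Y → ℝ} (hr : ∀ y' y, 0 < r y' y) (hrs : ∀ y', ∑ y, r y' y = 1) (n : ℕ) :
    ch.directedInfo P₀ π n ≤ ∑ t ∈ Finset.range n,
      ch.cost r (pairLaw (ch.inputLaw P₀ π t) (fun s => s.1 (Fin.last t))
        (fun s => s.2 (Fin.last t))) :=
  Finset.sum_le_sum fun t _ => ch.condMutualInfo_jointLaw_le hP₀ hπ hr hrs t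

theorem directedInfo_nonneg (hP₀ : P₀ ∈ stdSimplex ℝ Y) (hπ : IsInputDist π) (n : ℕ) :
    0 ≤ ch.directedInfo P₀ π n := by
  refine Finset.sum_nonneg fun t _ => ?_
  simp only [jointLaw_succ_snoc]
  exact condMutualInfo_mul_kernel_nonneg (m := fun a c => ch.inputLaw P₀ π t (a, c))
    (κ := fun a c b => ch.Q (a (Fin.last t)) (c (Fin.last t)) b)
    (fun _ _ => ch.inputLaw_nonneg hP₀ hπ _ _)
    (fun _ _ _ => ch.pos _ _ _) (fun _ _ => ch.sum_eq_one _ _)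

end Joint

theorem exists_isInputDist (X Y : Type*) [Fintype X] [Nonempty X] :
    ∃ π : InputDist X Y, IsInputDist π := by
  classical
  exact ⟨fun _ _ _ => Pi.single (Classical.arbitrary X) 1,
    fun _ _ _ => single_mem_stdSimplex ℝ _⟩

/-! ### Codes -/

section Code

variable (ch : NOSTChannel X Y) (P₀ : Y → ℝ) {M : ℕ} (f : Encoder X Y M)

theorem outputLaw_snoc (w : Fin M) (n : ℕ) (y : Fin (n + 1) → Y) (b : Y) :
    ch.outputLaw P₀ f w (n + 1) (Fin.snoc (α := fun _ => Y) y b) =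
      ch.outputLaw P₀ f w n y * ch.Q (f n w y) (y (Fin.last n)) b := by
  unfold outputLaw
  rw [Fin.prod_univ_castSucc]
  have h0 : Fin.snoc (α := fun _ => Y) y b 0 = y 0 := snoc_mk y b (Nat.succ_pos n) _
  have h1 : ∀ t : Fin n,
      ch.Q (f t.castSucc w
          fun i : Fin (t.castSucc + 1) => Fin.snoc (α := fun _ => Y) y b ⟨i, by grind⟩)
        (Fin.snoc (α := fun _ => Y) y b t.castSucc.castSucc)
        (Fin.snoc (α := fun _ => Y) y b t.castSucc.succ) =
      ch.Q (f t w fun i : Fin (t + 1) => y ⟨i, by omega⟩) (y t.castSucc) (y t.succ) := by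
    intro t
    rw [← Fin.castSucc_succ]
    simp only [Fin.snoc_castSucc]
    congr 2
    funext i
    exact snoc_mk y b _ _
  have h2 : f (Fin.last n) w
      (fun i : Fin (Fin.last n + 1) => Fin.snoc (α := fun _ => Y) y b ⟨i, by grind⟩) =
      f n w y := by
    have e : (fun i : Fin (n + 1) => Fin.snoc (α := fun _ => Y) y b ⟨i, by omega⟩) = y :=
      funext fun i => snoc_mk y b _ _
    exact congrArg (f n w) e
  rw [h0, h2, Finset.prod_congr rfl fun t _ => h1 t, Fin.snoc_castSucc, Fin.succ_last,
    Fin.snoc_last, mul_assoc]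

/-- The log-likelihood ratio between the output law for the message `w` and the law of a Markov
chain with transition kernel `r`. -/
def logRatio (r : Y → Y → ℝ) (w : Fin M) (n : ℕ) (y : Fin (n + 1) → Y) : ℝ :=
  ∑ t : Fin n, Real.log (ch.Q (f t w fun i : Fin (t + 1) => y ⟨i, by omega⟩) (y t.castSucc)
    (y t.succ) / r (y t.castSucc) (y t.succ))

theorem logRatio_snoc (r : Y → Y → ℝ) (w : Fin M) (n : ℕ) (y : Fin (n + 1) → Y) (b : Y) :
    ch.logRatio f r w (n + 1) (Fin.snoc (α := fun _ => Y) y b) =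
      ch.logRatio f r w n y +
        Real.log (ch.Q (f n w y) (y (Fin.last n)) b / r (y (Fin.last n)) b) := by
  unfold logRatio
  rw [Fin.sum_univ_castSucc]
  have h1 : ∀ t : Fin n,
      (f t.castSucc w
          fun i : Fin (t.castSucc + 1) => Fin.snoc (α := fun _ => Y) y b ⟨i, by grind⟩) =
      f t w fun i : Fin (t + 1) => y ⟨i, by omega⟩ := fun t =>
    congrArg (f t w) (funext fun i => snoc_mk y b _ _)
  have h2 : f (Fin.last n) w
      (fun i : Fin (Fin.last n + 1) => Fin.snoc (α := fun _ => Y) y b ⟨i, by grind⟩) =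
      f n w y := by
    have e : (fun i : Fin (n + 1) => Fin.snoc (α := fun _ => Y) y b ⟨i, by omega⟩) = y :=
      funext fun i => snoc_mk y b _ _
    exact congrArg (f n w) e
  rw [h2, Fin.snoc_castSucc, Fin.succ_last, Fin.snoc_last]
  simp only [h1, ← Fin.castSucc_succ, Fin.snoc_castSucc]

variable {P₀}

theorem outputLaw_nonneg (hP₀ : P₀ ∈ stdSimplex ℝ Y) (w : Fin M) (n : ℕ)
    (y : Fin (n + 1) → Y) : 0 ≤ ch.outputLaw P₀ f w n y :=
  mul_nonneg (hP₀.1 _) (Finset.prod_nonneg fun _ _ => (ch.pos _ _ _).le)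

theorem sum_outputLaw (hP₀ : P₀ ∈ stdSimplex ℝ Y) (w : Fin M) (n : ℕ) :
    ∑ y, ch.outputLaw P₀ f w n y = 1 := by
  induction n with
  | zero =>
    rw [sum_fin_succ_eq_sum_snoc, Fintype.sum_unique]
    simpa [outputLaw, Fin.snoc] using hP₀.2
  | succ n ih =>
    rw [sum_fin_succ_eq_sum_snoc]
    simp only [outputLaw_snoc, ← Finset.mul_sum, ch.sum_eq_one, mul_one, ih]

/-- The chain rule for relative entropy: each new output adds one logarithm, and summing it out
leaves the earlier terms unchanged. -/
theorem sum_outputLaw_mul_logRatio (r : Y → Y → ℝ) (w : Fin M) (n : ℕ) :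
    ∑ y, ch.outputLaw P₀ f w n y * ch.logRatio f r w n y =
      ∑ t ∈ Finset.range n, ∑ y, ch.outputLaw P₀ f w t y *
        ∑ b, ch.Q (f t w y) (y (Fin.last t)) b *
          Real.log (ch.Q (f t w y) (y (Fin.last t)) b / r (y (Fin.last t)) b) := by
  induction n with
  | zero => simp [logRatio]
  | succ n ih =>
    rw [Finset.sum_range_succ, ← ih, sum_fin_succ_eq_sum_snoc, ← Finset.sum_add_distrib]
    refine Finset.sum_congr rfl fun y _ => ?_
    simp only [outputLaw_snoc, logRatio_snoc, mul_add, Finset.sum_add_distrib]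
    congr 1
    · rw [← Finset.sum_mul, ← Finset.mul_sum, ch.sum_eq_one, mul_one]
    · simp only [Finset.mul_sum, mul_assoc]

/-- The joint law of the message and the outputs `Y_0, …, Y_n`. -/
def codeLaw (P₀ : Y → ℝ) (n : ℕ) (s : Fin M × (Fin (n + 1) → Y)) : ℝ :=
  ch.outputLaw P₀ f s.1 n s.2 / M

theorem codeLaw_nonneg (hP₀ : P₀ ∈ stdSimplex ℝ Y) (n : ℕ) (s : Fin M × (Fin (n + 1) → Y)) :
    0 ≤ ch.codeLaw f P₀ n s :=
  div_nonneg (ch.outputLaw_nonneg f hP₀ _ _ _) M.cast_nonneg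

theorem sum_codeLaw (hM : M ≠ 0) (hP₀ : P₀ ∈ stdSimplex ℝ Y) (n : ℕ) :
    ∑ s, ch.codeLaw f P₀ n s = 1 := by
  rw [Fintype.sum_prod_type]
  simp only [codeLaw, ← Finset.sum_div, sum_outputLaw _ _ hP₀, Finset.sum_const,
    Finset.card_univ, Fintype.card_fin, nsmul_eq_mul, mul_one]
  exact div_self (Nat.cast_ne_zero.2 hM)

/-- The Markov chain with transition kernel `r`, as a channel that ignores its input. -/
def ofKernel (X : Type*) (r : Y → Y → ℝ) (hr : ∀ y' y, 0 < r y' y)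
    (hrs : ∀ y', ∑ y, r y' y = 1) : NOSTChannel X Y where
  Q _ := r
  pos _ := hr
  sum_eq_one _ := hrs

/-- A form of Fano's inequality: the number of messages is controlled by the mean log-likelihood
ratio with respect to a Markov chain. -/
theorem log_card_le_sum_codeLaw_mul_logRatio (hM : M ≠ 0) (hP₀ : P₀ ∈ stdSimplex ℝ Y)
    {r : Y → Y → ℝ} (hr : ∀ y' y, 0 < r y' y) (hrs : ∀ y', ∑ y, r y' y = 1) (n : ℕ)
    (g : (Fin (n + 1) → Y) → Fin M) :
    (1 - ch.errorProb P₀ f n g) * Real.log M ≤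
      ∑ s, ch.codeLaw f P₀ n s * ch.logRatio f r s.1 n s.2 + Real.log 2 := by
  have hM0 : (0 : ℝ) < M := Nat.cast_pos.2 (Nat.pos_of_ne_zero hM)
  -- The law of the Markov chain started from `P₀`; it does not depend on the message, so `w₀` is
  -- only a representative.
  let q := (ofKernel X r hr hrs).outputLaw P₀ f
  let w₀ : Fin M := ⟨0, Nat.pos_of_ne_zero hM⟩
  have hq : ∀ w y, q w n y = q w₀ n y := fun _ _ => rfl
  -- The comparison law: outputs follow the Markov chain, and given them the message is the decoded
  -- one with weight `1 / 2` and uniform with weight `1 / 2`. The uniform half keeps the message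
  -- factor positive where the decoder errs. Fano's inequality is nonnegativity of the relative
  -- entropy of `codeLaw` with respect to `T`.
  let T : Fin M × (Fin (n + 1) → Y) → ℝ := fun s =>
    q s.1 n s.2 * ((if g s.2 = s.1 then 1 / 2 else 0) + 1 / (2 * M))
  have hTs : ∑ s, T s = 1 := by
    rw [Fintype.sum_prod_type_right]
    have h : ∀ y, ∑ w, T (w, y) = q w₀ n y := fun y => by
      simp only [T, hq _ y]
      rw [← Finset.mul_sum, Finset.sum_add_distrib, Finset.sum_ite_eq, Finset.sum_const,
        Finset.card_univ, Fintype.card_fin, nsmul_eq_mul, if_pos (Finset.mem_univ _)]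
      field_simp
      norm_num
    simp only [h]
    exact sum_outputLaw _ f hP₀ w₀ n
  have hlog : ∀ s, ch.codeLaw f P₀ n s - T s ≤ ch.codeLaw f P₀ n s *
      (ch.logRatio f r s.1 n s.2 - Real.log M + Real.log 2 +
        if g s.2 ≠ s.1 then Real.log M else 0) := by
    rintro ⟨w, y⟩
    have hfac : (0 : ℝ) < (if g y = w then 1 / 2 else 0) + 1 / (2 * M) := by
      split_ifs <;> positivity
    rcases (hP₀.1 (y 0)).eq_or_lt with h0 | h0
    · simp [codeLaw, T, q, outputLaw, ← h0]
    have hQp : 0 < ∏ t : Fin n, ch.Q (f t w fun i : Fin (t + 1) => y ⟨i, by omega⟩)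
        (y t.castSucc) (y t.succ) := Finset.prod_pos fun _ _ => ch.pos _ _ _
    have hrp : 0 < ∏ t : Fin n, r (y t.castSucc) (y t.succ) :=
      Finset.prod_pos fun _ _ => hr _ _
    have hqe : q w n y = P₀ (y 0) * ∏ t : Fin n, r (y t.castSucc) (y t.succ) := rfl
    have hqp : 0 < q w n y := hqe ▸ mul_pos h0 hrp
    have hp : 0 < ch.outputLaw P₀ f w n y := mul_pos h0 hQp
    have hT : 0 < T (w, y) := mul_pos hqp hfac
    refine (sub_le_mul_log_sub_log (ch.codeLaw_nonneg f hP₀ n _) hT.le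
      fun h => absurd h hT.ne').trans ?_
    refine mul_le_mul_of_nonneg_left ?_ (ch.codeLaw_nonneg f hP₀ n _)
    have e1 : Real.log (ch.codeLaw f P₀ n (w, y)) =
        Real.log (P₀ (y 0)) + ∑ t : Fin n, Real.log (ch.Q (f t w fun i : Fin (t + 1) =>
          y ⟨i, by omega⟩) (y t.castSucc) (y t.succ)) - Real.log M := by
      unfold codeLaw
      rw [Real.log_div hp.ne' hM0.ne']
      unfold outputLaw
      rw [Real.log_mul h0.ne' hQp.ne', Real.log_prod fun _ _ => (ch.pos _ _ _).ne']
    have e2 : Real.log (T (w, y)) = Real.log (P₀ (y 0)) +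
        ∑ t : Fin n, Real.log (r (y t.castSucc) (y t.succ)) +
        Real.log ((if g y = w then 1 / 2 else 0) + 1 / (2 * M)) := by
      simp only [T]
      rw [Real.log_mul hqp.ne' hfac.ne', hqe, Real.log_mul h0.ne' hrp.ne',
        Real.log_prod fun _ _ => (hr _ _).ne']
    have e3 : ch.logRatio f r w n y = ∑ t : Fin n, Real.log (ch.Q (f t w fun i : Fin (t + 1) =>
          y ⟨i, by omega⟩) (y t.castSucc) (y t.succ)) -
        ∑ t : Fin n, Real.log (r (y t.castSucc) (y t.succ)) := by
      rw [← Finset.sum_sub_distrib]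
      exact Finset.sum_congr rfl fun t _ => Real.log_div (ch.pos _ _ _).ne' (hr _ _).ne'
    -- A correct decision costs at most `log 2`; an error costs exactly `log 2 + log M`.
    have e4 : -Real.log 2 - (if g y ≠ w then Real.log M else 0) ≤
        Real.log ((if g y = w then 1 / 2 else 0) + 1 / (2 * M)) := by
      by_cases hg : g y = w
      · simp only [hg, ne_eq, not_true_eq_false, if_false, if_true, sub_zero]
        rw [← Real.log_inv]
        refine Real.log_le_log (by norm_num) ?_
        have : (0 : ℝ) < 1 / (2 * M) := by positivity
        linarith
      · simp only [hg, ne_eq, not_false_eq_true, if_true, if_false, zero_add]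
        rw [one_div, Real.log_inv, Real.log_mul two_ne_zero hM0.ne']
        linarith
    rw [e1, e2, e3]
    linarith
  have hsum := Finset.sum_le_sum fun s (_ : s ∈ Finset.univ) => hlog s
  have herr : ∑ s, ch.codeLaw f P₀ n s * (if g s.2 ≠ s.1 then Real.log M else 0) =
      ch.errorProb P₀ f n g * Real.log M := by
    unfold errorProb
    rw [Fintype.sum_prod_type, Finset.sum_div, Finset.sum_mul]
    refine Finset.sum_congr rfl fun w _ => ?_
    rw [Finset.sum_div, Finset.sum_mul]
    refine Finset.sum_congr rfl fun y _ => ?_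
    unfold codeLaw
    split_ifs <;> simp
  simp only [mul_add, mul_sub, Finset.sum_add_distrib, Finset.sum_sub_distrib, ← Finset.sum_mul,
    hTs, ch.sum_codeLaw f hM hP₀, herr, one_mul, sub_self] at hsum
  linarith

variable [Fintype X]

/-- The sequence of laws of `(X_{t+1}, Y_t)` under a code. -/
theorem isOccupation_codeLaw (hM : M ≠ 0) (hP₀ : P₀ ∈ stdSimplex ℝ Y) :
    ch.IsOccupation fun t => pairLaw (ch.codeLaw f P₀ t) (fun s => f t s.1 s.2)
      (fun s => s.2 (Fin.last t)) where
  mem t := pairLaw_mem_stdSimplex _ _ (ch.codeLaw_nonneg f hP₀ t) (ch.sum_codeLaw f hM hP₀ t)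
  marginal t y := by
    classical
    have h := sum_pairLaw_mul (ch.codeLaw f P₀ t) (fun s => f t s.1 s.2)
      (fun s => s.2 (Fin.last t)) fun z => ch.Q z.1 z.2 y
    rw [Fintype.sum_prod_type] at h
    rw [sum_pairLaw_eq, h, Fintype.sum_prod_type, Fintype.sum_prod_type]
    refine Finset.sum_congr rfl fun w _ => ?_
    rw [sum_fin_succ_eq_sum_snoc]
    refine Finset.sum_congr rfl fun c _ => ?_
    simp only [codeLaw, Fin.snoc_last, outputLaw_snoc, Finset.sum_ite_eq', Finset.mem_univ,
      if_true]
    ring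

theorem sum_codeLaw_mul_logRatio (r : Y → Y → ℝ) (n : ℕ) :
    ∑ s, ch.codeLaw f P₀ n s * ch.logRatio f r s.1 n s.2 = ∑ t ∈ Finset.range n,
      ch.cost r (pairLaw (ch.codeLaw f P₀ t) (fun s => f t s.1 s.2)
        (fun s => s.2 (Fin.last t))) := by
  unfold cost
  simp only [sum_pairLaw_mul]
  simp only [Fintype.sum_prod_type, codeLaw, div_mul_eq_mul_div,
    ← Finset.sum_div, sum_outputLaw_mul_logRatio]
  rw [Finset.sum_comm]

end Code

/-! ### The coding problem -/

theorem ne_zero_of_hasCode [Nonempty Y] {ch : NOSTChannel X Y} {P₀ : Y → ℝ} {n M : ℕ} {ε : ℝ}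
    (h : ch.HasCode P₀ n M ε) : M ≠ 0 := by
  obtain ⟨f, g, -⟩ := h
  exact (g fun _ => Classical.arbitrary Y).pos.ne'

/-- Ensures that the supremum in `maxMessages` is over a nonempty set, hence attained once the set
is bounded. -/
theorem hasCode_one [Nonempty X] (ch : NOSTChannel X Y) (P₀ : Y → ℝ) (n : ℕ) {ε : ℝ}
    (hε : 0 ≤ ε) : ch.HasCode P₀ n 1 ε := by
  refine ⟨fun _ _ _ => Classical.arbitrary X, fun _ => 0, ?_⟩
  simpa [errorProb] using hε

/-- The largest achievable rate at error probability `ε` and large block length. -/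
def liminfRate (ch : NOSTChannel X Y) (P₀ : Y → ℝ) (ε : ℝ) : ℝ :=
  liminf (fun n : ℕ => Real.log (ch.maxMessages P₀ n ε) / n) atTop

theorem rate_nonneg (ch : NOSTChannel X Y) (P₀ : Y → ℝ) (ε : ℝ) (n : ℕ) :
    0 ≤ Real.log (ch.maxMessages P₀ n ε) / n :=
  div_nonneg (Real.log_natCast_nonneg _) n.cast_nonneg

variable [Fintype X]

/-- The weak converse: for long block lengths, `(1 - ε) log M` is at most about `n * Cmax`. -/
theorem eventually_log_card_le [Nonempty X] [Nonempty Y] (ch : NOSTChannel X Y) {P₀ : Y → ℝ}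
    (hP₀ : P₀ ∈ stdSimplex ℝ Y) {Cmax δ : ℝ}
    (hC : IsGreatest (ch.singleLetterInfo '' ch.feasible) Cmax) (hδ : 0 < δ) :
    ∀ᶠ n : ℕ in atTop, ∀ M ε, ch.HasCode P₀ n M ε →
      (1 - ε) * Real.log M ≤ n * (Cmax + δ) + Real.log 2 := by
  filter_upwards [ch.eventually_exists_sum_cost_le hC hδ] with n hn M ε h
  have hM := ne_zero_of_hasCode h
  obtain ⟨f, g, hfg⟩ := h
  obtain ⟨r, hr, hrs, hle⟩ := hn _ (ch.isOccupation_codeLaw f hM hP₀)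
  rw [← ch.sum_codeLaw_mul_logRatio] at hle
  have h1 := ch.log_card_le_sum_codeLaw_mul_logRatio f hM hP₀ hr hrs n g
  have h2 : (1 - ε) * Real.log M ≤ (1 - ch.errorProb P₀ f n g) * Real.log M :=
    mul_le_mul_of_nonneg_right (by linarith) (Real.log_natCast_nonneg M)
  linarith

/-- Needed because `sSup` of an unbounded set of naturals is `0`; from here on `maxMessages` is a
genuine maximum for large `n`. -/
theorem eventually_bddAbove_hasCode [Nonempty X] [Nonempty Y] (ch : NOSTChannel X Y)
    {P₀ : Y → ℝ} (hP₀ : P₀ ∈ stdSimplex ℝ Y) {Cmax : ℝ}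
    (hC : IsGreatest (ch.singleLetterInfo '' ch.feasible) Cmax) {ε : ℝ} (hε : ε < 1) :
    ∀ᶠ n : ℕ in atTop, BddAbove {M : ℕ | ch.HasCode P₀ n M ε} := by
  filter_upwards [ch.eventually_log_card_le hP₀ hC one_pos] with n hn
  refine ⟨⌊Real.exp ((n * (Cmax + 1) + Real.log 2) / (1 - ε))⌋₊, fun M hM => Nat.le_floor ?_⟩
  have hM0 : (0 : ℝ) < M := Nat.cast_pos.2 (Nat.pos_of_ne_zero (ne_zero_of_hasCode hM))
  rw [← Real.log_le_iff_le_exp hM0, le_div_iff₀ (sub_pos.2 hε), mul_comm]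
  exact hn M ε hM

theorem eventually_rate_le [Nonempty X] [Nonempty Y] (ch : NOSTChannel X Y) {P₀ : Y → ℝ}
    (hP₀ : P₀ ∈ stdSimplex ℝ Y) {Cmax : ℝ}
    (hC : IsGreatest (ch.singleLetterInfo '' ch.feasible) Cmax) {ε δ : ℝ} (hε : 0 ≤ ε)
    (hε1 : ε < 1) (hδ : 0 < δ) :
    ∀ᶠ n : ℕ in atTop, Real.log (ch.maxMessages P₀ n ε) / n ≤ (Cmax + δ) / (1 - ε) := by
  have hlim : Tendsto (fun n : ℕ => Real.log 2 / n) atTop (𝓝 0) :=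
    tendsto_const_div_atTop_nhds_zero_nat _
  -- Half of `δ` is spent on the single-letter bound, the other half absorbs `log 2 / n`.
  filter_upwards [ch.eventually_log_card_le hP₀ hC (half_pos hδ),
    ch.eventually_bddAbove_hasCode hP₀ hC hε1, eventually_gt_atTop 0,
    hlim.eventually_le_const (half_pos hδ)] with n hn hb hn0 hl
  have hmem : ch.HasCode P₀ n (ch.maxMessages P₀ n ε) ε :=
    Nat.sSup_mem ⟨1, ch.hasCode_one P₀ n hε⟩ hb
  have hn0' : (0 : ℝ) < n := Nat.cast_pos.2 hn0
  have h := hn _ _ hmem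
  rw [div_le_iff₀ hn0'] at hl
  rw [le_div_iff₀ (sub_pos.2 hε1), div_mul_eq_mul_div, div_le_iff₀ hn0']
  linarith

theorem liminfRate_nonneg [Nonempty X] [Nonempty Y] (ch : NOSTChannel X Y) {P₀ : Y → ℝ}
    (hP₀ : P₀ ∈ stdSimplex ℝ Y) {Cmax : ℝ}
    (hC : IsGreatest (ch.singleLetterInfo '' ch.feasible) Cmax) {ε : ℝ} (hε : 0 ≤ ε)
    (hε1 : ε < 1) : 0 ≤ ch.liminfRate P₀ ε :=
  le_liminf_of_le (IsBoundedUnder.isCoboundedUnder_ge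
    ⟨_, eventually_map.2 (ch.eventually_rate_le hP₀ hC hε hε1 one_pos)⟩)
    (Eventually.of_forall (ch.rate_nonneg P₀ ε))

theorem liminfRate_le [Nonempty X] [Nonempty Y] (ch : NOSTChannel X Y) {P₀ : Y → ℝ}
    (hP₀ : P₀ ∈ stdSimplex ℝ Y) {Cmax : ℝ}
    (hC : IsGreatest (ch.singleLetterInfo '' ch.feasible) Cmax) {ε : ℝ} (hε : 0 ≤ ε)
    (hε1 : ε < 1) : ch.liminfRate P₀ ε ≤ Cmax / (1 - ε) := by
  have hle : ∀ δ > 0, ch.liminfRate P₀ ε ≤ (Cmax + δ) / (1 - ε) := fun δ hδ =>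
    liminf_le_of_frequently_le (ch.eventually_rate_le hP₀ hC hε hε1 hδ).frequently
      ⟨0, eventually_map.2 (Eventually.of_forall (ch.rate_nonneg P₀ ε))⟩
  rw [le_div_iff₀ (sub_pos.2 hε1)]
  refine le_of_forall_pos_le_add fun δ hδ => ?_
  exact (le_div_iff₀ (sub_pos.2 hε1)).1 (hle δ hδ)

/-- Monotonicity in the error probability is what makes the limit at `0` exist. -/
theorem liminfRate_mono [Nonempty X] [Nonempty Y] (ch : NOSTChannel X Y) {P₀ : Y → ℝ}
    (hP₀ : P₀ ∈ stdSimplex ℝ Y) {Cmax : ℝ}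
    (hC : IsGreatest (ch.singleLetterInfo '' ch.feasible) Cmax) {ε ε' : ℝ} (hε : 0 ≤ ε)
    (hle : ε ≤ ε') (hε' : ε' < 1) : ch.liminfRate P₀ ε ≤ ch.liminfRate P₀ ε' := by
  refine liminf_le_liminf ?_ ⟨0, eventually_map.2 (Eventually.of_forall (ch.rate_nonneg P₀ ε))⟩
    (IsBoundedUnder.isCoboundedUnder_ge
      ⟨_, eventually_map.2 (ch.eventually_rate_le hP₀ hC (hε.trans hle) hε' one_pos)⟩)
  filter_upwards [ch.eventually_bddAbove_hasCode hP₀ hC hε',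
    ch.eventually_bddAbove_hasCode hP₀ hC (hle.trans_lt hε')] with n hb hb'
  have hmem : ch.HasCode P₀ n (ch.maxMessages P₀ n ε) ε :=
    Nat.sSup_mem ⟨1, ch.hasCode_one P₀ n hε⟩ hb'
  have hpos : (0 : ℝ) < ch.maxMessages P₀ n ε :=
    Nat.cast_pos.2 (Nat.pos_of_ne_zero (ne_zero_of_hasCode hmem))
  refine div_le_div_of_nonneg_right (Real.log_le_log hpos (Nat.cast_le.2 (le_csSup hb ?_)))
    n.cast_nonneg
  obtain ⟨f, g, h⟩ := hmem
  exact ⟨f, g, h.trans hle⟩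

theorem exists_isFeedbackCapacity_le [Nonempty X] [Nonempty Y] (ch : NOSTChannel X Y)
    {P₀ : Y → ℝ} (hP₀ : P₀ ∈ stdSimplex ℝ Y) {Cmax : ℝ}
    (hC : IsGreatest (ch.singleLetterInfo '' ch.feasible) Cmax) :
    ∃ C, ch.IsFeedbackCapacity P₀ C ∧ C ≤ Cmax := by
  have hmono : MonotoneOn (ch.liminfRate P₀) (Set.Ioo 0 1) := fun ε h ε' h' hle =>
    ch.liminfRate_mono hP₀ hC h.1.le hle h'.2
  have hbdd : BddBelow (ch.liminfRate P₀ '' Set.Ioo 0 1) := ⟨0, by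
    rintro _ ⟨ε, h, rfl⟩
    exact ch.liminfRate_nonneg hP₀ hC h.1.le h.2⟩
  -- The capacity is the infimum of the rates over `0 < ε < 1`.
  have hlim := hmono.tendsto_nhdsWithin_Ioo_right (Set.nonempty_Ioo.2 one_pos) hbdd
  refine ⟨_, hlim, ?_⟩
  have hr : Tendsto (fun ε : ℝ => Cmax / (1 - ε)) (𝓝[>] 0) (𝓝 Cmax) := by
    have h : ContinuousAt (fun ε : ℝ => Cmax / (1 - ε)) 0 :=
      ContinuousAt.div (by fun_prop) (by fun_prop) (by norm_num)
    have h' := h.tendsto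
    simp only [sub_zero, div_one] at h'
    exact h'.mono_left nhdsWithin_le_nhds
  refine le_of_tendsto_of_tendsto hlim hr ?_
  filter_upwards [Ioo_mem_nhdsGT (one_pos : (0 : ℝ) < 1)] with ε h
  exact ch.liminfRate_le hP₀ hC h.1.le h.2

/-! ### The directed information -/

theorem limsup_maxDirectedInfo_le [Nonempty X] (ch : NOSTChannel X Y) {P₀ : Y → ℝ}
    (hP₀ : P₀ ∈ stdSimplex ℝ Y) {Cmax : ℝ}
    (hC : IsGreatest (ch.singleLetterInfo '' ch.feasible) Cmax) :
    limsup (fun n : ℕ => ch.maxDirectedInfo P₀ n) atTop ≤ Cmax := by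
  -- The lower bound is needed for the real `limsup` to be meaningful: without it the set of
  -- eventual upper bounds might be unbounded below.
  have hnn : ∀ n, 0 ≤ ch.maxDirectedInfo P₀ n := fun n => Real.sSup_nonneg <| by
    rintro _ ⟨π, hπ, rfl⟩
    exact div_nonneg (ch.directedInfo_nonneg hP₀ hπ n) n.cast_nonneg
  refine le_of_forall_pos_le_add fun δ hδ => ?_
  refine limsup_le_of_le (IsBoundedUnder.isCoboundedUnder_le
    ⟨0, eventually_map.2 (Eventually.of_forall hnn)⟩) ?_
  filter_upwards [ch.eventually_exists_sum_cost_le hC hδ, eventually_gt_atTop 0] with n hn hn0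
  obtain ⟨π₀, hπ₀⟩ := exists_isInputDist X Y
  refine csSup_le ⟨_, π₀, hπ₀, rfl⟩ ?_
  rintro _ ⟨π, hπ, rfl⟩
  obtain ⟨r, hr, hrs, hle⟩ := hn _ (ch.isOccupation_inputLaw hP₀ hπ)
  rw [div_le_iff₀ (Nat.cast_pos.2 hn0), mul_comm]
  exact (ch.directedInfo_le_sum_cost hP₀ hπ hr hrs n).trans hle

end NOSTChannel

end

/-- The single-letter maximum `max I(X ; Y | Y')` subject to `P_Y = P_{Y'}` exists, and it is an
upper bound for the feedback capacity of the NOST channel, both as defined by codes and as given by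
the limit of maximal normalized directed informations (here the limit superior). -/
theorem mainTheorem10 {X Y : Type*} [Fintype X] [Nonempty X] [Fintype Y]
    (ch : NOSTChannel X Y) (P₀ : Y → ℝ) (hP₀ : P₀ ∈ stdSimplex ℝ Y) :
    ∃ Cmax : ℝ, IsGreatest (ch.singleLetterInfo '' ch.feasible) Cmax ∧
      (∃ C : ℝ, ch.IsFeedbackCapacity P₀ C ∧ C ≤ Cmax) ∧
      Filter.limsup (fun n : ℕ => ch.maxDirectedInfo P₀ n) Filter.atTop ≤ Cmax := by
  have hY : Nonempty Y := by
    by_contra h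
    rw [not_nonempty_iff] at h
    simpa using hP₀.2
  -- Any strategy will do: its time averages accumulate at a feasible law, so the maximum is over a
  -- nonempty set.
  obtain ⟨π, hπ⟩ := NOSTChannel.exists_isInputDist X Y
  obtain ⟨Cmax, hC⟩ :=
    ch.exists_isGreatest_of_nonempty (ch.isOccupation_inputLaw hP₀ hπ).nonempty_feasible
  exact ⟨Cmax, hC, ch.exists_isFeedbackCapacity_le hP₀ hC, ch.limsup_maxDirectedInfo_le hP₀ hC⟩
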